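/- Let $a<T$ be real, $J=[a,T]$, and let $\psi\in C^1(J,\mathbb R)$ be increasing with $\psi'(t)\neq0$ for all $t\in J$. Let $0<\alpha\le1$, $0\le\beta\le1$, $\gamma=\alpha+\beta(1-\alpha)$ and $y_a\in\mathbb R$. For $\mu>0$ put $$I^{\mu;\psi}_{a+}u(t)=\frac1{\Gamma(\mu)}\int_a^t\psi'(s)\,(\psi(t)-\psi(s))^{\mu-1}u(s)\,ds,$$ let $I^{0;\psi}_{a+}$ be the identity, and let $${}^H\mathbb D^{\alpha,\beta;\psi}_{a+}y=I_{a+}^{\beta(1-\alpha);\psi}\Big(\frac1{\psi'}\frac{d}{dt}\Big)I_{a+}^{(1-\beta)(1-\alpha);\psi}y$$ be the $\psi$-Hilfer derivative. It is considered on the class $\mathcal D$ of functions $y:(a,T]\to\mathbb R$ such that $(\psi(t)-\psi(a))^{1-\gamma}y(t)$ extends to a continuous function on $[a,T]$, $I_{a+}^{(1-\beta)(1-\alpha);\psi}y$ is differentiable on $(a,T]$, and $\frac1{\psi'}\frac{d}{dt}I_{a+}^{(1-\beta)(1-\alpha);\psi}y$ is continuous on $(a,T]$ and integrable. Let $f:J\times\mathbb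 R\times\mathbb R\to\mathbb R$ be continuous. Then for every $y\in\mathcal D$ the following are equivalent. 1. $y$ solves the Cauchy problem $${}^H\mathbb D^{\alpha,\beta;\psi}_{a+}y(t)=f\big(t,y(t),{}^H\mathbb D^{\alpha,\beta;\psi}_{a+}y(t)\big)\quad(a<t\le T),\qquad \lim_{t\to a+}I_{a+}^{1-\gamma;\psi}y(t)=y_a,$$ with ${}^H\mathbb D^{\alpha,\beta;\psi}_{a+}y$ continuous on $J$ (that is, extending continuously to $t=a$). 2. There is $g\in C(J,\mathbb R)$ such that, for all $t\in(a,T]$, $$y(t)=\frac{(\psi(t)-\psi(a))^{\gamma-1}}{\Gamma(\gamma)}\,y_a+I_{a+}^{\alpha;\psi}g(t)$$ and $$g(t)=f\Big(t,\ \frac{(\psi(t)-\psi(a))^{\gamma-1}}{\Gamma(\gamma)}\,y_a+I_{a+}^{\alpha;\psi}g(t),\ g(t)\Big).$$ -/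

import Mathlib

open Set Filter Topology MeasureTheory

noncomputable section

namespace PsiHilfer

/-- The derivative of `ψ` on the compact interval `[a, T]` (one-sided at the endpoints). -/
def dpsi (a T : ℝ) (ψ : ℝ → ℝ) (t : ℝ) : ℝ :=
  derivWithin ψ (Icc a T) t

/-- The left-sided Riemann-Liouville fractional integral of order `μ ≥ 0` of `u` with respect to
`ψ` on `[a, T]`,
`I^{μ;ψ} u (t) = (1 / Γ(μ)) ∫ₐᵗ ψ'(s) (ψ(t) - ψ(s))^{μ-1} u(s) ds` for `μ > 0`,
with the usual convention that `I^{0;ψ}` is the identity. -/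
def fracInt (a T : ℝ) (ψ : ℝ → ℝ) (μ : ℝ) (u : ℝ → ℝ) (t : ℝ) : ℝ :=
  if μ = 0 then u t
  else (1 / Real.Gamma μ) * ∫ s in a..t, dpsi a T ψ s * (ψ t - ψ s) ^ (μ - 1) * u s

/-- The operator `(1 / ψ'(t)) d/dt` for functions on `(a, T]` (left derivative at `T`). -/
def psiDiff (a T : ℝ) (ψ : ℝ → ℝ) (u : ℝ → ℝ) (t : ℝ) : ℝ :=
  (1 / dpsi a T ψ t) * derivWithin u (Ioc a T) t

/-- The left-sided `ψ`-Hilfer fractional derivative of order `0 < α ≤ 1` and type `0 ≤ β ≤ 1`,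
`I^{β(1-α);ψ} (1/ψ' d/dt) I^{(1-β)(1-α);ψ} y`. -/
def hilferDeriv (a T : ℝ) (ψ : ℝ → ℝ) (α β : ℝ) (y : ℝ → ℝ) : ℝ → ℝ :=
  fracInt a T ψ (β * (1 - α)) (psiDiff a T ψ (fracInt a T ψ ((1 - β) * (1 - α)) y))

/-- A function given on `(a, T]` belongs to `C[a, T]`: it extends continuously to `[a, T]`. -/
def ExtendsContinuously (a T : ℝ) (u : ℝ → ℝ) : Prop :=
  ∃ φ : ℝ → ℝ, ContinuousOn φ (Icc a T) ∧ ∀ t ∈ Ioc a T, φ t = u t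

/-- The weighted space `C_{1-γ;ψ}[a, T]`: functions `u` on `(a, T]` such that
`(ψ(t) - ψ(a))^{1-γ} u(t)` belongs to `C[a, T]`. -/
def MemWeighted (a T : ℝ) (ψ : ℝ → ℝ) (γ : ℝ) (u : ℝ → ℝ) : Prop :=
  ExtendsContinuously a T (fun t => (ψ t - ψ a) ^ (1 - γ) * u t)

/-- The functions on `(a, T]` for which the `ψ`-Hilfer derivative of order `α` and type `β` is
defined: `y` lies in the weighted space `C_{1-γ;ψ}[a, T]` with `γ = α + β(1-α)`, the function
`I^{(1-β)(1-α);ψ} y` is differentiable on `(a, T]`, and `(1/ψ' d/dt) I^{(1-β)(1-α);ψ} y` is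
continuous on `(a, T]` and integrable, so that the outer fractional integral converges. -/
structure HilferDifferentiable (a T : ℝ) (ψ : ℝ → ℝ) (α β : ℝ) (y : ℝ → ℝ) : Prop where
  weighted : MemWeighted a T ψ (α + β * (1 - α)) y
  diff : DifferentiableOn ℝ (fracInt a T ψ ((1 - β) * (1 - α)) y) (Ioc a T)
  cont : ContinuousOn (psiDiff a T ψ (fracInt a T ψ ((1 - β) * (1 - α)) y)) (Ioc a T)
  integrable : IntegrableOn (psiDiff a T ψ (fracInt a T ψ ((1 - β) * (1 - α)) y)) (Ioc a T)

/-- `y` solves the Cauchy problem `D y (t) = f (t, y(t), D y (t))`, `I^{1-γ;ψ} y (a) = y_a`, where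
`D` is the `ψ`-Hilfer derivative, with `D y ∈ C[a, T]`. The equation holds on `(a, T]`, where `y`
lives, and the initial value is the limit at `a` from the right. -/
structure IsSolution (a T : ℝ) (ψ : ℝ → ℝ) (α β : ℝ) (f : ℝ → ℝ → ℝ → ℝ) (ya : ℝ)
    (y : ℝ → ℝ) : Prop where
  hilferDifferentiable : HilferDifferentiable a T ψ α β y
  deriv_cont : ExtendsContinuously a T (hilferDeriv a T ψ α β y)
  equation : ∀ t ∈ Ioc a T, hilferDeriv a T ψ α β y t = f t (y t) (hilferDeriv a T ψ α β y t)
  initial : Tendsto (fracInt a T ψ (1 - (α + β * (1 - α))) y) (𝓝[>] a) (𝓝 ya)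

/-- The right-hand side `(ψ(t) - ψ(a))^{γ-1} y_a / Γ(γ) + I^{α;ψ} g (t)` of the integral
equation. -/
def volterra (a T : ℝ) (ψ : ℝ → ℝ) (α γ ya : ℝ) (g : ℝ → ℝ) (t : ℝ) : ℝ :=
  (ψ t - ψ a) ^ (γ - 1) / Real.Gamma γ * ya + fracInt a T ψ α g t

end PsiHilfer

end

open Set Filter Topology MeasureTheory

noncomputable section

namespace PsiHilfer

/-! The substitution `x = ψ(s)` removes `ψ`: with `c = ψ(a)`, every `ψ`-fractional integral becomes
a classical Riemann-Liouville integral `I^μ` based at `c` (`fracInt_eq_rlInt`). Put `σ = β(1-α)`, so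
that `γ = α + σ` and `(1-β)(1-α) = 1-γ`. Let `Y`, `G` be the transported `y`, `g`, and `W` the
transported `(1/ψ') d/dt I^{1-γ;ψ} y`. The Hilfer derivative becomes `I^σ W`, and the fundamental
theorem of calculus turns the initial condition into `I^{1-γ} Y = y_a + I^1 W`.

Everything then follows from the semigroup law `I^μ I^ν = I^{μ+ν}` (Tonelli and the beta integral,
`rlInt_rlInt`) and the injectivity of `I^1` on functions continuous and integrable on a half-open
interval (`eqOn_of_integral_eq`).

If `I^σ W = G`, applying `I^γ` gives `I^1 Y = I^γ y_a + I^{γ+1} W`, and the right side is `I^1` of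
the Volterra expression; cancelling `I^1` yields the integral equation (`eq_add_rlInt_of_rlInt_eq`).
Conversely, applying `I^{1-γ}` to the integral equation gives `I^{1-γ} Y = y_a + I^{1-σ} G`
(`rlInt_eq_add_rlInt`). As `σ < 1`, the last term vanishes at `c`, which is the initial condition;
hence `I^1 W = I^{1-σ} G`, and applying `I^σ` and cancelling `I^1` gives `I^σ W = G`
(`rlInt_eq_of_rlInt_one_eq`). -/

/-- The classical left-sided Riemann-Liouville fractional integral with base point `c`. -/
def rlInt (c μ : ℝ) (u : ℝ → ℝ) (x : ℝ) : ℝ :=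
  if μ = 0 then u x else (1 / Real.Gamma μ) * ∫ s in c..x, (x - s) ^ (μ - 1) * u s

/-! ### Riemann-Liouville integrals and the semigroup law -/

lemma rlInt_zero (c : ℝ) (u : ℝ → ℝ) (x : ℝ) : rlInt c 0 u x = u x := if_pos rfl

lemma rlInt_of_pos {μ : ℝ} (hμ : 0 < μ) (c : ℝ) (u : ℝ → ℝ) (x : ℝ) :
    rlInt c μ u x = (1 / Real.Gamma μ) * ∫ s in c..x, (x - s) ^ (μ - 1) * u s :=
  if_neg hμ.ne'

lemma rlInt_one (c : ℝ) (u : ℝ → ℝ) (x : ℝ) : rlInt c 1 u x = ∫ s in c..x, u s := by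
  simp [rlInt]

lemma rlInt_congr {c x μ : ℝ} {u v : ℝ → ℝ} (hx : c < x) (h : EqOn u v (Ioc c x)) :
    rlInt c μ u x = rlInt c μ v x := by
  unfold rlInt
  split_ifs
  · exact h ⟨hx, le_rfl⟩
  · congr 1
    refine intervalIntegral.integral_congr_ae (ae_of_all _ fun s hs => ?_)
    rw [uIoc_of_le hx.le] at hs
    simp only [h hs]

/-- Euler's beta integral, translated and scaled. The complex version transfers because both bases
are nonnegative on the range, where real and complex powers agree. -/
lemma integral_sub_rpow_mul_sub_rpow {s x μ ν : ℝ} (hsx : s < x) (hμ : 0 < μ) (hν : 0 < ν) :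
    ∫ τ in s..x, (x - τ) ^ (μ - 1) * (τ - s) ^ (ν - 1) =
      (x - s) ^ (μ + ν - 1) * ProbabilityTheory.beta μ ν := by
  have hpos : 0 < x - s := sub_pos.2 hsx
  have h1 : ∫ τ in s..x, (x - τ) ^ (μ - 1) * (τ - s) ^ (ν - 1) =
      ∫ τ in (0 : ℝ)..(x - s), τ ^ (ν - 1) * (x - s - τ) ^ (μ - 1) := by
    have := intervalIntegral.integral_comp_sub_right (a := s) (b := x)
      (fun τ => τ ^ (ν - 1) * (x - s - τ) ^ (μ - 1)) s
    rw [sub_self] at this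
    rw [← this]
    refine intervalIntegral.integral_congr fun τ _ => ?_
    rw [mul_comm]
    congr 2
    ring
  have h2 := Complex.betaIntegral_scaled (ν : ℂ) (μ : ℂ) hpos
  have h3 : ((∫ τ in (0 : ℝ)..(x - s), τ ^ (ν - 1) * (x - s - τ) ^ (μ - 1) : ℝ) : ℂ) =
      ∫ τ in (0 : ℝ)..(x - s), (τ : ℂ) ^ ((ν : ℂ) - 1) * (((x - s : ℝ) : ℂ) - τ) ^ ((μ : ℂ) - 1) := by
    rw [← intervalIntegral.integral_ofReal]
    refine intervalIntegral.integral_congr fun τ hτ => ?_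
    rw [uIcc_of_le hpos.le] at hτ
    rw [Complex.ofReal_mul, Complex.ofReal_cpow hτ.1, Complex.ofReal_cpow (sub_nonneg.2 hτ.2)]
    push_cast
    rfl
  rw [h2] at h3
  rw [h1, ← Complex.ofReal_inj, h3, Complex.ofReal_mul, Complex.ofReal_cpow hpos.le]
  congr 1
  · push_cast; congr 1; ring
  · rw [Complex.betaIntegral_symm, Complex.betaIntegral_eq_Gamma_mul_div _ _ (by simpa) (by simpa),
      ProbabilityTheory.beta]
    push_cast
    simp only [← Complex.ofReal_add, Complex.Gamma_ofReal]

/-- A non-integrable function has integral `0` by convention, while this integral is positive. -/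
lemma intervalIntegrable_sub_rpow_mul_sub_rpow {s x μ ν : ℝ} (hsx : s < x) (hμ : 0 < μ)
    (hν : 0 < ν) :
    IntervalIntegrable (fun τ => (x - τ) ^ (μ - 1) * (τ - s) ^ (ν - 1)) volume s x := by
  refine intervalIntegral.intervalIntegrable_of_integral_ne_zero ?_
  rw [integral_sub_rpow_mul_sub_rpow hsx hμ hν]
  have := ProbabilityTheory.beta_pos hμ hν
  have := Real.rpow_pos_of_pos (sub_pos.2 hsx) (μ + ν - 1)
  positivity

/-- The kernel of the composition of two Riemann-Liouville integrals, as a function on a square. -/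
def triangleKernel (x μ ν : ℝ) (τ s : ℝ) : ℝ :=
  (Ioi s).indicator (fun τ => (x - τ) ^ (μ - 1) * (τ - s) ^ (ν - 1)) τ

lemma triangleKernel_nonneg {x μ ν τ s : ℝ} (hτ : τ < x) : 0 ≤ triangleKernel x μ ν τ s := by
  refine indicator_apply_nonneg fun h => ?_
  have h1 : 0 < x - τ := sub_pos.2 hτ
  have h2 : 0 < τ - s := sub_pos.2 h
  positivity

lemma measurable_triangleKernel (x μ ν : ℝ) :
    Measurable fun p : ℝ × ℝ => triangleKernel x μ ν p.1 p.2 := by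
  have : (fun p : ℝ × ℝ => triangleKernel x μ ν p.1 p.2) =
      {p : ℝ × ℝ | p.2 < p.1}.indicator fun p => (x - p.1) ^ (μ - 1) * (p.1 - p.2) ^ (ν - 1) := by
    ext p
    simp [triangleKernel, indicator]
  rw [this]
  exact Measurable.indicator (by fun_prop) (measurableSet_lt measurable_snd measurable_fst)

lemma Ioi_inter_Ioo_of_mem {c x s : ℝ} (hs : s ∈ Ioo c x) : Ioo c x ∩ Ioi s = Ioo s x := by
  ext τ
  simp only [mem_inter_iff, mem_Ioo, mem_Ioi]
  exact ⟨fun h => ⟨h.2, h.1.2⟩, fun h => ⟨⟨hs.1.trans h.1, h.2⟩, h.1⟩⟩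

lemma integrableOn_triangleKernel {c x s μ ν : ℝ} (hs : s ∈ Ioo c x) (hμ : 0 < μ) (hν : 0 < ν) :
    IntegrableOn (fun τ => triangleKernel x μ ν τ s) (Ioo c x) := by
  have h := (intervalIntegrable_iff_integrableOn_Ioo_of_le hs.2.le).1
    (intervalIntegrable_sub_rpow_mul_sub_rpow hs.2 hμ hν)
  have : IntegrableOn ((Ioi s).indicator
      (fun τ => (x - τ) ^ (μ - 1) * (τ - s) ^ (ν - 1))) (Ioo c x) := by
    rw [IntegrableOn, integrable_indicator_iff measurableSet_Ioi, IntegrableOn,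
      Measure.restrict_restrict measurableSet_Ioi, inter_comm, Ioi_inter_Ioo_of_mem hs]
    exact h
  exact this

lemma integral_triangleKernel {c x s μ ν : ℝ} (hs : s ∈ Ioo c x) (hμ : 0 < μ) (hν : 0 < ν) :
    ∫ τ in Ioo c x, triangleKernel x μ ν τ s =
      (x - s) ^ (μ + ν - 1) * ProbabilityTheory.beta μ ν := by
  rw [← integral_sub_rpow_mul_sub_rpow hs.2 hμ hν, intervalIntegral.integral_of_le hs.2.le,
    integral_Ioc_eq_integral_Ioo, ← Ioi_inter_Ioo_of_mem hs, ← setIntegral_indicator measurableSet_Ioi]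
  rfl

/-- Tonelli's criterion for the iterated Riemann-Liouville integral. -/
lemma integrable_triangleKernel_mul {c x μ ν : ℝ} (hμ : 0 < μ) (hν : 0 < ν) {u : ℝ → ℝ}
    (hu : IntegrableOn (fun s => (x - s) ^ (μ + ν - 1) * u s) (Ioo c x)) :
    Integrable (fun p : ℝ × ℝ => triangleKernel x μ ν p.1 p.2 * u p.2)
      ((volume.restrict (Ioo c x)).prod (volume.restrict (Ioo c x))) := by
  -- Measurability of `u` is recovered by dividing out the weight, which is positive on `(c, x)`.
  have hmeas : AEStronglyMeasurable u (volume.restrict (Ioo c x)) := by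
    have h1 : AEStronglyMeasurable (fun s => (x - s) ^ (-(μ + ν - 1)) * ((x - s) ^ (μ + ν - 1) * u s))
        (volume.restrict (Ioo c x)) := by
      refine AEStronglyMeasurable.mul ?_ hu.1
      exact Measurable.aestronglyMeasurable (by fun_prop)
    refine h1.congr ?_
    filter_upwards [ae_restrict_mem measurableSet_Ioo] with s hs
    have := Real.rpow_pos_of_pos (sub_pos.2 hs.2) (μ + ν - 1)
    rw [Real.rpow_neg (sub_pos.2 hs.2).le, inv_mul_cancel_left₀ this.ne']
  have hF : AEStronglyMeasurable (fun p : ℝ × ℝ => triangleKernel x μ ν p.1 p.2 * u p.2)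
      ((volume.restrict (Ioo c x)).prod (volume.restrict (Ioo c x))) :=
    (measurable_triangleKernel x μ ν).aestronglyMeasurable.mul hmeas.comp_snd
  rw [integrable_prod_iff' hF]
  constructor
  · filter_upwards [ae_restrict_mem measurableSet_Ioo] with s hs
    exact (integrableOn_triangleKernel hs hμ hν).mul_const (u s)
  · refine (hu.norm.mul_const (ProbabilityTheory.beta μ ν)).congr ?_
    filter_upwards [ae_restrict_mem measurableSet_Ioo] with s hs
    have h1 : ∫ τ in Ioo c x, ‖triangleKernel x μ ν τ s * u s‖ =
        ∫ τ in Ioo c x, triangleKernel x μ ν τ s * |u s| := by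
      refine setIntegral_congr_fun measurableSet_Ioo fun τ hτ => ?_
      simp only [Real.norm_eq_abs, abs_mul]
      rw [abs_of_nonneg (triangleKernel_nonneg hτ.2)]
    rw [h1, integral_mul_const, integral_triangleKernel hs hμ hν, Real.norm_eq_abs, abs_mul,
      abs_of_pos (Real.rpow_pos_of_pos (sub_pos.2 hs.2) _)]
    ring

/-- The inner integral in the other order of integration; the cutoff `s < τ` shortens the range to
`(c, τ)`. -/
lemma integral_triangleKernel_mul {c x μ ν τ : ℝ} (u : ℝ → ℝ) (hν : 0 < ν) (hτ : τ ∈ Ioo c x) :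
    ∫ s in Ioo c x, triangleKernel x μ ν τ s * u s =
      Real.Gamma ν * ((x - τ) ^ (μ - 1) * rlInt c ν u τ) := by
  have : Ioo c τ = Ioo c x ∩ Iio τ := by
    ext s
    simp only [mem_inter_iff, mem_Ioo, mem_Iio]
    exact ⟨fun h => ⟨⟨h.1, h.2.trans hτ.2⟩, h.2⟩, fun h => ⟨h.1.1, h.2⟩⟩
  have hΓ := (Real.Gamma_pos_of_pos hν).ne'
  rw [rlInt_of_pos hν, mul_left_comm ((x - τ) ^ (μ - 1)), ← mul_assoc, mul_one_div_cancel hΓ,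
    one_mul, intervalIntegral.integral_of_le hτ.1.le, integral_Ioc_eq_integral_Ioo, this,
    ← integral_const_mul, ← setIntegral_indicator measurableSet_Iio]
  refine setIntegral_congr_fun measurableSet_Ioo fun s _ => ?_
  simp only [triangleKernel, indicator, mem_Ioi, mem_Iio]
  split_ifs <;> ring

lemma integrableOn_sub_rpow_mul_rlInt {c x μ ν : ℝ} (hμ : 0 < μ) (hν : 0 < ν) {u : ℝ → ℝ}
    (hu : IntegrableOn (fun s => (x - s) ^ (μ + ν - 1) * u s) (Ioo c x)) :
    IntegrableOn (fun τ => (x - τ) ^ (μ - 1) * rlInt c ν u τ) (Ioo c x) := by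
  refine ((integrable_triangleKernel_mul hμ hν hu).integral_prod_left.const_mul
    (Real.Gamma ν)⁻¹).congr ?_
  filter_upwards [ae_restrict_mem measurableSet_Ioo] with τ hτ
  rw [integral_triangleKernel_mul u hν hτ,
    inv_mul_cancel_left₀ (Real.Gamma_pos_of_pos hν).ne']

/-- The semigroup property of the Riemann-Liouville integrals at a point where the integral of
order `μ + ν` converges absolutely. -/
lemma rlInt_rlInt_of_pos {c x μ ν : ℝ} (hcx : c < x) (hμ : 0 < μ) (hν : 0 < ν) {u : ℝ → ℝ}
    (hu : IntegrableOn (fun s => (x - s) ^ (μ + ν - 1) * u s) (Ioo c x)) :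
    rlInt c μ (rlInt c ν u) x = rlInt c (μ + ν) u x := by
  have hswap := integral_integral_swap (f := fun τ s => triangleKernel x μ ν τ s * u s)
    (integrable_triangleKernel_mul hμ hν hu)
  have hR : ∫ s in Ioo c x, ∫ τ in Ioo c x, triangleKernel x μ ν τ s * u s =
      ProbabilityTheory.beta μ ν * ∫ s in Ioo c x, (x - s) ^ (μ + ν - 1) * u s := by
    rw [← integral_const_mul]
    refine setIntegral_congr_fun measurableSet_Ioo fun s hs => ?_
    rw [integral_mul_const, integral_triangleKernel hs hμ hν]
    ring
  have hL : ∫ τ in Ioo c x, ∫ s in Ioo c x, triangleKernel x μ ν τ s * u s =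
      Real.Gamma ν * ∫ τ in Ioo c x, (x - τ) ^ (μ - 1) * rlInt c ν u τ := by
    rw [← integral_const_mul]
    exact setIntegral_congr_fun measurableSet_Ioo fun τ hτ => integral_triangleKernel_mul u hν hτ
  rw [hL, hR] at hswap
  have hΓ := Real.Gamma_pos_of_pos hμ
  have hΓ' := Real.Gamma_pos_of_pos hν
  have hΓ'' := Real.Gamma_pos_of_pos (add_pos hμ hν)
  rw [rlInt_of_pos hμ, rlInt_of_pos (add_pos hμ hν), intervalIntegral.integral_of_le hcx.le,
    integral_Ioc_eq_integral_Ioo, intervalIntegral.integral_of_le hcx.le,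
    integral_Ioc_eq_integral_Ioo]
  rw [ProbabilityTheory.beta] at hswap
  field_simp at hswap ⊢
  linear_combination hswap

/-- Order zero must be allowed: `σ = 0` and `γ = 1` both occur at the ends of the parameter range.
-/
lemma rlInt_rlInt {c x μ ν : ℝ} (hcx : c < x) (hμ : 0 ≤ μ) (hν : 0 ≤ ν) {u : ℝ → ℝ}
    (hu : IntegrableOn (fun s => (x - s) ^ (μ + ν - 1) * u s) (Ioo c x)) :
    rlInt c μ (rlInt c ν u) x = rlInt c (μ + ν) u x := by
  rcases hμ.eq_or_lt with rfl | hμ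
  · rw [rlInt_zero, zero_add]
  rcases hν.eq_or_lt with rfl | hν
  · rw [add_zero, show rlInt c 0 u = u from funext (rlInt_zero c u)]
  exact rlInt_rlInt_of_pos hcx hμ hν hu

/-! ### Integrability and continuity of fractional integrals -/

lemma integrableOn_sub_rpow_mul_of_nonneg {c x p : ℝ} (hp : 0 ≤ p) {u : ℝ → ℝ}
    (hu : IntegrableOn u (Ioo c x)) :
    IntegrableOn (fun s => (x - s) ^ p * u s) (Ioo c x) := by
  refine Integrable.bdd_mul (c := (x - c) ^ p) hu
    (Measurable.aestronglyMeasurable (by fun_prop)) ?_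
  filter_upwards [ae_restrict_mem measurableSet_Ioo] with s hs
  have h := sub_nonneg.2 hs.2.le
  rw [Real.norm_eq_abs, abs_of_nonneg (Real.rpow_nonneg h _)]
  exact Real.rpow_le_rpow h (by linarith [hs.1]) hp

lemma intervalIntegrable_sub_rpow_mul_of_continuousOn {c x p : ℝ} (hcx : c ≤ x) (hp : -1 < p)
    {u : ℝ → ℝ} (hu : ContinuousOn u (Icc c x)) :
    IntervalIntegrable (fun s => (x - s) ^ p * u s) volume c x := by
  have h : IntervalIntegrable (fun s => (x - s) ^ p) volume c x := by
    have := (intervalIntegral.intervalIntegrable_rpow' (a := x - c) (b := x - x) hp).comp_sub_left x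
    simpa using this
  exact h.mul_continuousOn (by rwa [uIcc_of_le hcx])

lemma integrableOn_sub_rpow_mul_of_continuousOn {c x p : ℝ} (hcx : c ≤ x) (hp : -1 < p)
    {u : ℝ → ℝ} (hu : ContinuousOn u (Icc c x)) :
    IntegrableOn (fun s => (x - s) ^ p * u s) (Ioo c x) :=
  (intervalIntegrable_iff_integrableOn_Ioo_of_le hcx).1
    (intervalIntegrable_sub_rpow_mul_of_continuousOn hcx hp hu)

lemma rlInt_add {c x μ : ℝ} (hμ : 0 ≤ μ) {u v : ℝ → ℝ}
    (hu : IntervalIntegrable (fun s => (x - s) ^ (μ - 1) * u s) volume c x)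
    (hv : IntervalIntegrable (fun s => (x - s) ^ (μ - 1) * v s) volume c x) :
    rlInt c μ (fun s => u s + v s) x = rlInt c μ u x + rlInt c μ v x := by
  rcases hμ.eq_or_lt with rfl | hμ
  · simp [rlInt_zero]
  · simp only [rlInt_of_pos hμ, mul_add]
    rw [intervalIntegral.integral_add hu hv, mul_add]

lemma rlInt_base {c μ : ℝ} (hμ : 0 < μ) (u : ℝ → ℝ) : rlInt c μ u c = 0 := by
  simp [rlInt_of_pos hμ]

/-- Substituting `s = c + (x - c) r` frees both the limits and the singular kernel from `x`, which
prepares for dominated convergence. -/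
lemma rlInt_eq_integral_unit {c x μ : ℝ} (hμ : 0 < μ) (hcx : c ≤ x) (u : ℝ → ℝ) :
    rlInt c μ u x = (1 / Real.Gamma μ) * ((x - c) ^ μ *
      ∫ r in (0 : ℝ)..1, (1 - r) ^ (μ - 1) * u (c + (x - c) * r)) := by
  rcases hcx.eq_or_lt with rfl | hcx
  · simp [rlInt_of_pos hμ, Real.zero_rpow hμ.ne']
  rw [rlInt_of_pos hμ]
  congr 1
  have hpos := sub_pos.2 hcx
  have h := intervalIntegral.smul_integral_comp_add_mul (a := 0) (b := 1)
    (fun s => (x - s) ^ (μ - 1) * u s) (x - c) c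
  rw [mul_zero, add_zero, mul_one, add_sub_cancel, smul_eq_mul] at h
  rw [← h]
  have h2 : (x - c) ^ μ = (x - c) * (x - c) ^ (μ - 1) := by
    rw [Real.rpow_sub_one hpos.ne']
    field_simp
  rw [h2, mul_assoc]
  congr 1
  rw [← intervalIntegral.integral_const_mul]
  refine intervalIntegral.integral_congr fun r hr => ?_
  rw [uIcc_of_le zero_le_one] at hr
  rw [show x - (c + (x - c) * r) = (x - c) * (1 - r) by ring,
    Real.mul_rpow hpos.le (sub_nonneg.2 hr.2), mul_assoc]

lemma continuousOn_rlInt {c d μ : ℝ} (hμ : 0 < μ) {g : ℝ → ℝ} (hg : ContinuousOn g (Icc c d)) :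
    ContinuousOn (rlInt c μ g) (Icc c d) := by
  have hmaps : ∀ x ∈ Icc c d, ∀ r ∈ Icc (0 : ℝ) 1, c + (x - c) * r ∈ Icc c d := by
    intro x hx r hr
    have h := sub_nonneg.2 hx.1
    constructor
    · nlinarith [hr.1]
    · nlinarith [hr.2, hx.2]
  obtain ⟨M, hM⟩ := isCompact_Icc.exists_bound_of_continuousOn hg
  have hker : IntervalIntegrable (fun r : ℝ => (1 - r) ^ (μ - 1) * M) volume 0 1 :=
    intervalIntegrable_sub_rpow_mul_of_continuousOn zero_le_one (by linarith) continuousOn_const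
  have hJ : ContinuousOn
      (fun x => ∫ r in (0 : ℝ)..1, (1 - r) ^ (μ - 1) * g (c + (x - c) * r)) (Icc c d) := by
    intro x₀ hx₀
    refine intervalIntegral.continuousWithinAt_of_dominated_interval ?_ ?_ hker ?_
    · filter_upwards [self_mem_nhdsWithin] with x hx
      have := intervalIntegrable_sub_rpow_mul_of_continuousOn (p := μ - 1) zero_le_one
        (by linarith) (u := fun r => g (c + (x - c) * r))
        (hg.comp (by fun_prop) (fun r hr => hmaps x hx r hr))
      rw [intervalIntegrable_iff] at this
      exact this.1
    · filter_upwards [self_mem_nhdsWithin] with x hx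
      refine ae_of_all _ fun r hr => ?_
      rw [uIoc_of_le zero_le_one] at hr
      rw [norm_mul, Real.norm_of_nonneg (Real.rpow_nonneg (sub_nonneg.2 hr.2) _)]
      exact mul_le_mul_of_nonneg_left (hM _ (hmaps x hx r ⟨hr.1.le, hr.2⟩))
        (Real.rpow_nonneg (sub_nonneg.2 hr.2) _)
    · refine ae_of_all _ fun r hr => ?_
      rw [uIoc_of_le zero_le_one] at hr
      refine continuousWithinAt_const.mul ?_
      have : ContinuousOn (fun x => g (c + (x - c) * r)) (Icc c d) :=
        hg.comp (by fun_prop) (fun x hx => hmaps x hx r ⟨hr.1.le, hr.2⟩)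
      exact this x₀ hx₀
  refine ContinuousOn.congr (continuousOn_const.mul (ContinuousOn.mul ?_ hJ))
    (fun x hx => rlInt_eq_integral_unit hμ hx.1 g)
  exact ContinuousOn.rpow_const (by fun_prop) (fun x _ => Or.inr hμ.le)

lemma tendsto_rlInt_nhdsGT {c d μ : ℝ} (hcd : c < d) (hμ : 0 < μ) {g : ℝ → ℝ}
    (hg : ContinuousOn g (Icc c d)) : Tendsto (rlInt c μ g) (𝓝[>] c) (𝓝 0) := by
  have h := continuousOn_rlInt hμ hg c (left_mem_Icc.2 hcd.le)
  rw [ContinuousWithinAt, rlInt_base hμ] at h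
  exact h.mono_left (nhdsWithin_le_of_mem (mem_of_superset (Ioc_mem_nhdsGT hcd) Ioc_subset_Icc_self))

lemma continuousAt_integral_sub_rpow_mul {c δ x₀ p : ℝ} (hcδ : c ≤ δ) (hδ : δ < x₀)
    {W : ℝ → ℝ} (hW : IntegrableOn W (Ioc c δ)) :
    ContinuousAt (fun x => ∫ s in c..δ, (x - s) ^ p * W s) x₀ := by
  -- For `x ≥ e` the difference `x - s` stays at least `e - δ > 0`, so the kernel is uniformly
  -- bounded near `x₀`.
  obtain ⟨e, he1, he2⟩ := exists_between hδ
  have hcont : ContinuousOn (fun z : ℝ => z ^ p) (Icc (e - δ) (x₀ + 1 - c)) :=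
    ContinuousOn.rpow_const continuousOn_id fun z hz => Or.inl (by
      have := hz.1; linarith)
  obtain ⟨M, hM⟩ := isCompact_Icc.exists_bound_of_continuousOn hcont
  have hnear : ∀ᶠ x in 𝓝 x₀, x ∈ Icc e (x₀ + 1) := Icc_mem_nhds he2 (by linarith)
  rw [← intervalIntegrable_iff_integrableOn_Ioc_of_le hcδ] at hW
  refine intervalIntegral.continuousAt_of_dominated_interval (bound := fun s => M * ‖W s‖)
    ?_ ?_ (hW.norm.const_mul M) ?_
  · refine Eventually.of_forall fun x => ?_
    rw [intervalIntegrable_iff] at hW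
    exact AEStronglyMeasurable.mul (Measurable.aestronglyMeasurable (by fun_prop)) hW.1
  · filter_upwards [hnear] with x hx
    refine ae_of_all _ fun s hs => ?_
    rw [uIoc_of_le hcδ] at hs
    rw [norm_mul]
    refine mul_le_mul_of_nonneg_right (hM _ ⟨?_, ?_⟩) (norm_nonneg _)
    · linarith [hx.1, hs.2]
    · linarith [hx.2, hs.1]
  · refine ae_of_all _ fun s hs => ?_
    rw [uIoc_of_le hcδ] at hs
    refine ContinuousAt.mul ?_ continuousAt_const
    refine ContinuousAt.rpow_const (by fun_prop) (Or.inl ?_)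
    linarith [hs.2]

lemma integrableOn_sub_rpow_mul_of_lt {c δ x p : ℝ} (hδ : δ < x) {W : ℝ → ℝ}
    (hW : IntegrableOn W (Ioc c δ)) :
    IntegrableOn (fun s => (x - s) ^ p * W s) (Ioc c δ) := by
  have hcont : ContinuousOn (fun s : ℝ => (x - s) ^ p) (Icc c δ) :=
    ContinuousOn.rpow_const (by fun_prop) fun s hs => Or.inl (by linarith [hs.2])
  rw [← integrableOn_Icc_iff_integrableOn_Ioc] at hW ⊢
  exact hW.continuousOn_mul hcont isCompact_Icc

/-- Here `W` may be unbounded near `c`. Splitting at some `δ` in `(c, x₀)` separates the two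
singularities: on `(c, δ]` the kernel is regular for `x` near `x₀`, and on `[δ, d]` the function `W`
is continuous. -/
lemma continuousOn_rlInt_Ioc {c d μ : ℝ} (hμ : 0 ≤ μ) {W : ℝ → ℝ}
    (hW : ContinuousOn W (Ioc c d)) (hWi : IntegrableOn W (Ioc c d)) :
    ContinuousOn (rlInt c μ W) (Ioc c d) := by
  rcases hμ.eq_or_lt with rfl | hμ
  · exact hW.congr fun x _ => rlInt_zero c W x
  intro x₀ hx₀
  obtain ⟨δ, hcδ, hδ⟩ := exists_between hx₀.1
  have hWδ : ContinuousOn W (Icc δ d) := hW.mono fun s hs => ⟨hcδ.trans_le hs.1, hs.2⟩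
  have hWic : IntegrableOn W (Ioc c δ) :=
    hWi.mono_set (Ioc_subset_Ioc_right (hδ.le.trans hx₀.2))
  have hev : (fun x => (1 / Real.Gamma μ) * (∫ s in c..δ, (x - s) ^ (μ - 1) * W s) + rlInt δ μ W x)
      =ᶠ[𝓝[Ioc c d] x₀] rlInt c μ W := by
    filter_upwards [self_mem_nhdsWithin, mem_nhdsWithin_of_mem_nhds (Ioi_mem_nhds hδ)] with x hx hxδ
    rw [rlInt_of_pos hμ, rlInt_of_pos hμ, ← mul_add, intervalIntegral.integral_add_adjacent_intervals]
    · rw [intervalIntegrable_iff_integrableOn_Ioc_of_le hcδ.le]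
      exact integrableOn_sub_rpow_mul_of_lt hxδ hWic
    · exact intervalIntegrable_sub_rpow_mul_of_continuousOn (le_of_lt hxδ) (by linarith)
        (hWδ.mono (Icc_subset_Icc_right hx.2))
  refine ContinuousWithinAt.congr_of_eventuallyEq ?_ hev.symm
    (hev.self_of_nhdsWithin hx₀).symm
  refine ContinuousWithinAt.add (continuousWithinAt_const.mul
    (continuousAt_integral_sub_rpow_mul hcδ.le hδ hWic).continuousWithinAt) ?_
  refine (continuousOn_rlInt hμ hWδ x₀ ⟨hδ.le, hx₀.2⟩).mono_of_mem_nhdsWithin ?_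
  filter_upwards [self_mem_nhdsWithin, mem_nhdsWithin_of_mem_nhds (Ioi_mem_nhds hδ)] with x hx hxδ
  exact ⟨le_of_lt hxδ, hx.2⟩

/-- Continuous functions with equal primitives are equal. -/
lemma eqOn_of_integral_eq {c d : ℝ} {u v : ℝ → ℝ}
    (hu : ContinuousOn u (Ioc c d)) (hui : IntegrableOn u (Ioc c d))
    (hv : ContinuousOn v (Ioc c d)) (hvi : IntegrableOn v (Ioc c d))
    (h : ∀ x ∈ Ioc c d, ∫ s in c..x, u s = ∫ s in c..x, v s) : EqOn u v (Ioc c d) := by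
  have key : ∀ w : ℝ → ℝ, ContinuousOn w (Ioc c d) → IntegrableOn w (Ioc c d) → ∀ x ∈ Ioc c d,
      HasDerivWithinAt (fun z => ∫ s in c..z, w s) (w x) (Iic x) x := by
    intro w hw hwi x hx
    -- Left derivatives are used so that the endpoint `x = d` is covered as well.
    have hmem : Ioc c d ∈ 𝓝[Iic x] x :=
      mem_of_superset (Ioc_mem_nhdsLE hx.1) (Ioc_subset_Ioc_right hx.2)
    refine intervalIntegral.integral_hasDerivWithinAt_right ?_ ⟨Ioc c d, hmem, hwi.1⟩
      ((hw x hx).mono_of_mem_nhdsWithin hmem)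
    rw [intervalIntegrable_iff_integrableOn_Ioc_of_le hx.1.le]
    exact hwi.mono_set (Ioc_subset_Ioc_right hx.2)
  intro x hx
  have h1 := key u hu hui x hx
  have h2 := key v hv hvi x hx
  have hev : (fun z => ∫ s in c..z, u s) =ᶠ[𝓝[Iic x] x] fun z => ∫ s in c..z, v s := by
    filter_upwards [Ioc_mem_nhdsLE hx.1] with z hz
    exact h z ⟨hz.1, hz.2.trans hx.2⟩
  have h3 := h2.congr_of_eventuallyEq hev (h x hx)
  exact (uniqueDiffWithinAt_Iic x).eq_deriv _ h1 h3

/-! ### Fractional integrals of constants and powers -/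

lemma rlInt_const {c x μ : ℝ} (hμ : 0 < μ) (k : ℝ) :
    rlInt c μ (fun _ => k) x = (x - c) ^ μ / Real.Gamma (μ + 1) * k := by
  rw [rlInt_of_pos hμ, intervalIntegral.integral_mul_const,
    intervalIntegral.integral_comp_sub_left (fun s => s ^ (μ - 1)), sub_self,
    integral_rpow (Or.inl (by linarith)), Real.Gamma_add_one hμ.ne', sub_add_cancel,
    Real.zero_rpow hμ.ne']
  have := Real.Gamma_pos_of_pos hμ
  field_simp
  ring

lemma integral_sub_rpow_div_Gamma {c x γ : ℝ} (hγ : 0 < γ) (k : ℝ) :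
    ∫ s in c..x, (s - c) ^ (γ - 1) / Real.Gamma γ * k =
      (x - c) ^ γ / Real.Gamma (γ + 1) * k := by
  rw [intervalIntegral.integral_mul_const, intervalIntegral.integral_div,
    intervalIntegral.integral_comp_sub_right (fun s => s ^ (γ - 1)), sub_self,
    integral_rpow (Or.inl (by linarith)), Real.Gamma_add_one hγ.ne', sub_add_cancel,
    Real.zero_rpow hγ.ne']
  have := Real.Gamma_pos_of_pos hγ
  field_simp
  ring

/-- For `γ < 1` the exponents add up so that the power of `x - c` disappears, and `B(1-γ, γ) =
Γ(1-γ) Γ(γ)` cancels the normalisations. -/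
lemma rlInt_sub_rpow {c x γ : ℝ} (hγ : 0 < γ) (hγ1 : γ ≤ 1) (hcx : c < x) (k : ℝ) :
    rlInt c (1 - γ) (fun s => (s - c) ^ (γ - 1) / Real.Gamma γ * k) x = k := by
  rcases hγ1.eq_or_lt with rfl | hγ1
  · simp [rlInt_zero]
  have h := sub_pos.2 hγ1
  have := integral_sub_rpow_mul_sub_rpow hcx h hγ
  rw [sub_add_cancel, sub_self, Real.rpow_zero, one_mul, ProbabilityTheory.beta, sub_add_cancel,
    Real.Gamma_one, div_one] at this
  have hΓ := Real.Gamma_pos_of_pos hγ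
  have hΓ' := Real.Gamma_pos_of_pos h
  have h2 : ∀ s, (x - s) ^ (1 - γ - 1) * ((s - c) ^ (γ - 1) / Real.Gamma γ * k) =
      (k / Real.Gamma γ) * ((x - s) ^ (1 - γ - 1) * (s - c) ^ (γ - 1)) := fun s => by ring
  simp only [rlInt_of_pos h, h2]
  rw [intervalIntegral.integral_const_mul, this]
  field_simp

lemma integrableOn_sub_rpow {c d γ : ℝ} (hγ : 0 < γ) :
    IntegrableOn (fun s => (s - c) ^ (γ - 1)) (Ioc c d) := by
  rcases le_or_gt c d with hcd | hcd
  · rw [← intervalIntegrable_iff_integrableOn_Ioc_of_le hcd]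
    have := (intervalIntegral.intervalIntegrable_rpow' (a := c - c) (b := d - c)
      (r := γ - 1) (by linarith)).comp_sub_right c
    simpa using this
  · simp [Ioc_eq_empty hcd.not_gt]

lemma intervalIntegrable_of_Ioo {c x : ℝ} (hcx : c ≤ x) {u : ℝ → ℝ} (h : IntegrableOn u (Ioo c x)) :
    IntervalIntegrable u volume c x :=
  (intervalIntegrable_iff_integrableOn_Ioo_of_le hcx).2 h

/-! ### Inversion of the fractional equations -/

/-- Inversion of `I^{1-γ} Y = k + I^1 W`, where `γ = α + σ`, in terms of `G = I^σ W`. -/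
lemma eq_add_rlInt_of_rlInt_eq {c d α σ k : ℝ} (hα : 0 < α) (hσ : 0 ≤ σ) (hασ : α + σ ≤ 1)
    {Y W G : ℝ → ℝ} (hY : ContinuousOn Y (Ioc c d)) (hYi : IntegrableOn Y (Ioc c d))
    (hWi : IntegrableOn W (Ioc c d)) (hG : ContinuousOn G (Icc c d))
    (hWG : ∀ x ∈ Ioc c d, rlInt c σ W x = G x)
    (hYW : ∀ x ∈ Ioc c d, rlInt c (1 - (α + σ)) Y x = k + rlInt c 1 W x) :
    ∀ x ∈ Ioc c d, Y x = (x - c) ^ (α + σ - 1) / Real.Gamma (α + σ) * k + rlInt c α G x := by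
  have hγ : 0 < α + σ := by linarith
  have hαG := continuousOn_rlInt hα hG
  have hαGi : IntegrableOn (rlInt c α G) (Ioc c d) :=
    (hαG.integrableOn_compact isCompact_Icc).mono_set Ioc_subset_Icc_self
  have hpi : IntegrableOn (fun x => (x - c) ^ (α + σ - 1) / Real.Gamma (α + σ) * k) (Ioc c d) :=
    ((integrableOn_sub_rpow hγ).div_const _).mul_const _
  have hpc : ContinuousOn (fun x => (x - c) ^ (α + σ - 1) / Real.Gamma (α + σ) * k) (Ioc c d) := by
    refine ContinuousOn.mul (ContinuousOn.div_const ?_ _) continuousOn_const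
    exact ContinuousOn.rpow_const (by fun_prop) fun x hx => Or.inl (sub_pos.2 hx.1).ne'
  refine eqOn_of_integral_eq hY hYi (hpc.add (hαG.mono Ioc_subset_Icc_self)) (hpi.add hαGi) ?_
  intro x hx
  have hsub : Ioc c x ⊆ Ioc c d := Ioc_subset_Ioc_right hx.2
  have hWx : IntegrableOn W (Ioo c x) := hWi.mono_set (Ioo_subset_Ioc_self.trans hsub)
  have hYx : IntegrableOn Y (Ioo c x) := hYi.mono_set (Ioo_subset_Ioc_self.trans hsub)
  have hGx : ContinuousOn G (Icc c x) := hG.mono (Icc_subset_Icc_right hx.2)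
  -- `I^1 Y = I^γ I^{1-γ} Y = I^γ (k + I^1 W)`.
  have hleft : ∫ s in c..x, Y s =
      (x - c) ^ (α + σ) / Real.Gamma (α + σ + 1) * k + rlInt c (α + σ + 1) W x := by
    have hW1 : IntegrableOn (fun s => (x - s) ^ (α + σ + 1 - 1) * W s) (Ioo c x) :=
      integrableOn_sub_rpow_mul_of_nonneg (by linarith) hWx
    rw [← rlInt_one, ← rlInt_rlInt hx.1 hγ.le zero_le_one hW1, ← rlInt_const hγ,
      ← rlInt_add hγ.le, ← rlInt_congr hx.1 fun s hs => hYW s (hsub hs),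
      rlInt_rlInt hx.1 hγ.le (sub_nonneg.2 hασ), add_sub_cancel]
    · rw [add_sub_cancel]
      exact integrableOn_sub_rpow_mul_of_nonneg (by simp) hYx
    · exact intervalIntegrable_sub_rpow_mul_of_continuousOn hx.1.le (by linarith) continuousOn_const
    · exact intervalIntegrable_of_Ioo hx.1.le (integrableOn_sub_rpow_mul_rlInt hγ one_pos hW1)
  -- `I^1 I^α G = I^{1+α} I^σ W`, of total order `γ + 1`.
  have hright : ∫ s in c..x, rlInt c α G s = rlInt c (α + σ + 1) W x := by
    rw [← rlInt_one, rlInt_rlInt hx.1 zero_le_one hα.le, ← rlInt_congr hx.1 fun s hs => hWG s (hsub hs),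
      rlInt_rlInt hx.1 (by linarith) hσ]
    · congr 1; ring
    · exact integrableOn_sub_rpow_mul_of_nonneg (by linarith) hWx
    · exact integrableOn_sub_rpow_mul_of_continuousOn hx.1.le (by linarith) hGx
  rw [hleft, intervalIntegral.integral_add, hright, integral_sub_rpow_div_Gamma hγ]
  · rw [intervalIntegrable_iff_integrableOn_Ioc_of_le hx.1.le]
    exact hpi.mono_set hsub
  · rw [intervalIntegrable_iff_integrableOn_Ioc_of_le hx.1.le]
    exact hαGi.mono_set hsub

lemma rlInt_eq_add_rlInt {c d α σ k : ℝ} (hα : 0 < α) (hσ : 0 ≤ σ) (hασ : α + σ ≤ 1)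
    {Y G : ℝ → ℝ} (hG : ContinuousOn G (Icc c d))
    (hY : ∀ x ∈ Ioc c d,
      Y x = (x - c) ^ (α + σ - 1) / Real.Gamma (α + σ) * k + rlInt c α G x) :
    ∀ x ∈ Ioc c d, rlInt c (1 - (α + σ)) Y x = k + rlInt c (1 - σ) G x := by
  intro x hx
  have hγ : 0 < α + σ := by linarith
  have hsub : Ioc c x ⊆ Ioc c d := Ioc_subset_Ioc_right hx.2
  have hGx : ContinuousOn G (Icc c x) := hG.mono (Icc_subset_Icc_right hx.2)
  rw [rlInt_congr hx.1 fun s hs => hY s (hsub hs)]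
  -- At `γ = 1` the outer operator is the identity; its formal kernel `(x - s)^{-1}` would not be
  -- integrable.
  rcases hασ.eq_or_lt with h | h
  · have : α = 1 - σ := by linarith
    rw [h, sub_self, rlInt_zero, this]
    simp
  have hν : 0 < 1 - (α + σ) := sub_pos.2 h
  rw [rlInt_add hν.le, rlInt_sub_rpow hγ hασ hx.1, rlInt_rlInt hx.1 hν.le hα.le]
  · congr 2; ring
  · exact integrableOn_sub_rpow_mul_of_continuousOn hx.1.le (by linarith) hGx
  · have := ((intervalIntegrable_sub_rpow_mul_sub_rpow hx.1 hν hγ).div_const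
      (Real.Gamma (α + σ))).mul_const k
    refine this.congr fun s _ => ?_
    ring
  · exact intervalIntegrable_sub_rpow_mul_of_continuousOn hx.1.le (by linarith)
      (continuousOn_rlInt hα hGx)

/-- Inversion of `I^1 W = I^{1-σ} G`. -/
lemma rlInt_eq_of_rlInt_one_eq {c d σ : ℝ} (hσ : 0 ≤ σ) (hσ1 : σ < 1) {W G : ℝ → ℝ}
    (hW : ContinuousOn W (Ioc c d)) (hWi : IntegrableOn W (Ioc c d))
    (hG : ContinuousOn G (Icc c d))
    (h : ∀ x ∈ Ioc c d, rlInt c 1 W x = rlInt c (1 - σ) G x) :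
    ∀ x ∈ Ioc c d, rlInt c σ W x = G x := by
  rcases le_or_gt d c with hdc | hcd
  · simp [Ioc_eq_empty hdc.not_gt]
  have hWd : IntegrableOn W (Ioo c d) := hWi.mono_set Ioo_subset_Ioc_self
  have hσWi : IntegrableOn (rlInt c σ W) (Ioc c d) := by
    rcases hσ.eq_or_lt with rfl | hσ
    · rwa [show rlInt c 0 W = W from funext (rlInt_zero c W)]
    rw [integrableOn_Ioc_iff_integrableOn_Ioo]
    -- Tonelli with outer order `1`, whose weight is `(d - τ)^0 = 1`.
    simpa using integrableOn_sub_rpow_mul_rlInt (x := d) one_pos hσ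
      (integrableOn_sub_rpow_mul_of_nonneg (by linarith) hWd)
  refine eqOn_of_integral_eq (continuousOn_rlInt_Ioc hσ hW hWi) hσWi
    (hG.mono Ioc_subset_Icc_self)
    ((hG.integrableOn_compact isCompact_Icc).mono_set Ioc_subset_Icc_self) ?_
  intro x hx
  have hsub : Ioc c x ⊆ Ioc c d := Ioc_subset_Ioc_right hx.2
  have hWx : IntegrableOn W (Ioo c x) := hWi.mono_set (Ioo_subset_Ioc_self.trans hsub)
  -- `I^1 I^σ W = I^σ I^1 W = I^σ I^{1-σ} G = I^1 G`.
  rw [← rlInt_one, ← rlInt_one, rlInt_rlInt hx.1 zero_le_one hσ, add_comm 1 σ,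
    ← rlInt_rlInt hx.1 hσ zero_le_one, rlInt_congr hx.1 fun s hs => h s (hsub hs),
    rlInt_rlInt hx.1 hσ (by linarith), add_sub_cancel]
  · exact integrableOn_sub_rpow_mul_of_continuousOn hx.1.le (by linarith)
      (hG.mono (Icc_subset_Icc_right hx.2))
  · exact integrableOn_sub_rpow_mul_of_nonneg (by linarith) hWx
  · exact integrableOn_sub_rpow_mul_of_nonneg (by linarith) hWx

/-! ### The change of variable `x = ψ(s)` -/

variable {a T : ℝ} {ψ : ℝ → ℝ}

/-- The inverse of `ψ` on `[a, T]`. -/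
def psiInv (a T : ℝ) (ψ : ℝ → ℝ) : ℝ → ℝ := Function.invFunOn ψ (Icc a T)

lemma dpsi_pos (hψmono : MonotoneOn ψ (Icc a T))
    (hψ' : ∀ t ∈ Icc a T, derivWithin ψ (Icc a T) t ≠ 0) {t : ℝ} (ht : t ∈ Icc a T) :
    0 < dpsi a T ψ t :=
  lt_of_le_of_ne hψmono.derivWithin_nonneg (hψ' t ht).symm

lemma strictMonoOn_psi (hψc : ContinuousOn ψ (Icc a T)) (hψmono : MonotoneOn ψ (Icc a T))
    (hψ' : ∀ t ∈ Icc a T, derivWithin ψ (Icc a T) t ≠ 0) : StrictMonoOn ψ (Icc a T) := by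
  refine strictMonoOn_of_deriv_pos (convex_Icc a T) hψc fun t ht => ?_
  rw [← derivWithin_of_mem_nhds (mem_interior_iff_mem_nhds.1 ht)]
  exact dpsi_pos hψmono hψ' (interior_subset ht)

lemma psiInv_psi (hψ : StrictMonoOn ψ (Icc a T)) {t : ℝ} (ht : t ∈ Icc a T) :
    psiInv a T ψ (ψ t) = t :=
  hψ.injOn.leftInvOn_invFunOn ht

lemma image_psi_Ioc (hψc : ContinuousOn ψ (Icc a T)) (hψ : StrictMonoOn ψ (Icc a T)) {t : ℝ}
    (ht : t ∈ Icc a T) : ψ '' Ioc a t = Ioc (ψ a) (ψ t) := by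
  refine Subset.antisymm ?_ (intermediate_value_Ioc ht.1 (hψc.mono (Icc_subset_Icc_right ht.2)))
  rintro _ ⟨s, hs, rfl⟩
  have hs' : s ∈ Icc a T := ⟨hs.1.le, hs.2.trans ht.2⟩
  exact ⟨hψ ⟨le_rfl, ht.1.trans ht.2⟩ hs' hs.1, hψ.monotoneOn hs' ht hs.2⟩

lemma image_psi_Icc (haT : a ≤ T) (hψc : ContinuousOn ψ (Icc a T))
    (hψ : StrictMonoOn ψ (Icc a T)) : ψ '' Icc a T = Icc (ψ a) (ψ T) := by
  refine Subset.antisymm ?_ (intermediate_value_Icc haT hψc)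
  rintro _ ⟨s, hs, rfl⟩
  exact ⟨hψ.monotoneOn ⟨le_rfl, haT⟩ hs hs.1, hψ.monotoneOn hs ⟨haT, le_rfl⟩ hs.2⟩

lemma mapsTo_psiInv_Ioc (haT : a ≤ T) (hψc : ContinuousOn ψ (Icc a T))
    (hψ : StrictMonoOn ψ (Icc a T)) : MapsTo (psiInv a T ψ) (Ioc (ψ a) (ψ T)) (Ioc a T) := by
  rw [← image_psi_Ioc hψc hψ (right_mem_Icc.2 haT)]
  rintro _ ⟨t, ht, rfl⟩
  rwa [psiInv_psi hψ (Ioc_subset_Icc_self ht)]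

lemma mapsTo_psiInv_Icc (haT : a ≤ T) (hψc : ContinuousOn ψ (Icc a T))
    (hψ : StrictMonoOn ψ (Icc a T)) : MapsTo (psiInv a T ψ) (Icc (ψ a) (ψ T)) (Icc a T) := by
  rw [← image_psi_Icc haT hψc hψ]
  rintro _ ⟨t, ht, rfl⟩
  rwa [psiInv_psi hψ ht]

/-- Preimages under the inverse are images under `ψ`, and `ψ` sends closed subsets of the compact
interval to compact, hence closed, sets. -/
lemma continuousOn_psiInv (haT : a ≤ T) (hψc : ContinuousOn ψ (Icc a T))
    (hψ : StrictMonoOn ψ (Icc a T)) : ContinuousOn (psiInv a T ψ) (Icc (ψ a) (ψ T)) := by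
  rw [continuousOn_iff_isClosed]
  intro C hC
  refine ⟨ψ '' (C ∩ Icc a T), ?_, ?_⟩
  · exact ((isCompact_Icc.inter_left hC).image_of_continuousOn
      (hψc.mono inter_subset_right)).isClosed
  · rw [← image_psi_Icc haT hψc hψ]
    ext x
    constructor
    · rintro ⟨hx, t, ht, rfl⟩
      rw [mem_preimage, psiInv_psi hψ ht] at hx
      exact ⟨⟨t, ⟨hx, ht⟩, rfl⟩, t, ht, rfl⟩
    · rintro ⟨⟨t, ⟨htC, ht⟩, rfl⟩, hx⟩
      refine ⟨?_, hx⟩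
      rwa [mem_preimage, psiInv_psi hψ ht]

lemma hasDerivWithinAt_psi (hψd : DifferentiableOn ℝ ψ (Icc a T)) {s : Set ℝ} (hs : s ⊆ Icc a T)
    {t : ℝ} (ht : t ∈ s) : HasDerivWithinAt ψ (dpsi a T ψ t) s t :=
  (hψd t (hs ht)).hasDerivWithinAt.mono hs

lemma Ioc_subset_Icc_of_mem {t : ℝ} (ht : t ∈ Icc a T) : Ioc a t ⊆ Icc a T :=
  fun _ hs => ⟨hs.1.le, hs.2.trans ht.2⟩

/-- The substitution `x = ψ(s)`. -/
lemma fracInt_eq_rlInt (hψd : DifferentiableOn ℝ ψ (Icc a T)) (hψmono : MonotoneOn ψ (Icc a T))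
    (hψ' : ∀ t ∈ Icc a T, derivWithin ψ (Icc a T) t ≠ 0) (μ : ℝ) (u : ℝ → ℝ) {t : ℝ}
    (ht : t ∈ Icc a T) :
    fracInt a T ψ μ u t = rlInt (ψ a) μ (u ∘ psiInv a T ψ) (ψ t) := by
  have hψ := strictMonoOn_psi hψd.continuousOn hψmono hψ'
  have hat : ψ a ≤ ψ t := hψmono ⟨le_rfl, ht.1.trans ht.2⟩ ht ht.1
  unfold fracInt rlInt
  split_ifs
  · rw [Function.comp_apply, psiInv_psi hψ ht]
  · have hsub := Ioc_subset_Icc_of_mem ht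
    have := integral_image_eq_integral_abs_deriv_smul measurableSet_Ioc
      (fun s hs => hasDerivWithinAt_psi hψd hsub hs) (hψ.injOn.mono hsub)
      (fun x => (ψ t - x) ^ (μ - 1) * (u ∘ psiInv a T ψ) x)
    rw [intervalIntegral.integral_of_le ht.1, intervalIntegral.integral_of_le hat,
      ← image_psi_Ioc hψd.continuousOn hψ ht, this]
    congr 1
    refine setIntegral_congr_fun measurableSet_Ioc fun s hs => ?_
    simp only [smul_eq_mul, Function.comp_apply]
    rw [psiInv_psi hψ (hsub hs), abs_of_pos (dpsi_pos hψmono hψ' (hsub hs)), mul_assoc]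

lemma continuousOn_dpsi (haT : a < T) (hψ : ContDiffOn ℝ 1 ψ (Icc a T)) :
    ContinuousOn (dpsi a T ψ) (Icc a T) :=
  hψ.continuousOn_derivWithin (uniqueDiffOn_Icc haT) le_rfl

lemma integrableOn_dpsi_mul (haT : a < T) (hψ : ContDiffOn ℝ 1 ψ (Icc a T)) {w : ℝ → ℝ}
    (hw : IntegrableOn w (Ioc a T)) : IntegrableOn (fun s => dpsi a T ψ s * w s) (Ioc a T) := by
  rw [← integrableOn_Icc_iff_integrableOn_Ioc] at hw ⊢
  exact hw.continuousOn_mul (continuousOn_dpsi haT hψ) isCompact_Icc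

lemma integrableOn_comp_psiInv (haT : a < T) (hψ : ContDiffOn ℝ 1 ψ (Icc a T))
    (hψmono : MonotoneOn ψ (Icc a T)) (hψ' : ∀ t ∈ Icc a T, derivWithin ψ (Icc a T) t ≠ 0)
    {w : ℝ → ℝ} (hw : IntegrableOn w (Ioc a T)) :
    IntegrableOn (w ∘ psiInv a T ψ) (Ioc (ψ a) (ψ T)) := by
  have hψd := hψ.differentiableOn one_ne_zero
  have hψs := strictMonoOn_psi hψd.continuousOn hψmono hψ'
  rw [← image_psi_Ioc hψd.continuousOn hψs (right_mem_Icc.2 haT.le),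
    integrableOn_image_iff_integrableOn_abs_deriv_smul measurableSet_Ioc
      (fun s hs => hasDerivWithinAt_psi hψd Ioc_subset_Icc_self hs)
      (hψs.injOn.mono Ioc_subset_Icc_self)]
  refine (integrableOn_dpsi_mul haT hψ hw).congr_fun (fun s hs => ?_) measurableSet_Ioc
  have hs' := Ioc_subset_Icc_self hs
  simp only [smul_eq_mul, Function.comp_apply]
  rw [psiInv_psi hψs hs', abs_of_pos (dpsi_pos hψmono hψ' hs')]

/-- The fundamental theorem of calculus for the operator `(1 / ψ') d/dt` on `(a, T]`. -/
lemma eq_add_fracInt_one_psiDiff (haT : a < T) (hψ : ContDiffOn ℝ 1 ψ (Icc a T))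
    (hψ' : ∀ t ∈ Icc a T, derivWithin ψ (Icc a T) t ≠ 0) {v : ℝ → ℝ} {k : ℝ}
    (hv : DifferentiableOn ℝ v (Ioc a T)) (hi : IntegrableOn (psiDiff a T ψ v) (Ioc a T))
    (hk : Tendsto v (𝓝[>] a) (𝓝 k)) {t : ℝ} (ht : t ∈ Ioc a T) :
    v t = k + fracInt a T ψ 1 (psiDiff a T ψ v) t := by
  have hint := (integrableOn_dpsi_mul haT hψ hi).mono_set (Ioc_subset_Ioc_right ht.2)
  rw [← intervalIntegrable_iff_integrableOn_Ioc_of_le ht.1.le] at hint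
  have hmem : Ioc a T ∈ 𝓝[<] t :=
    mem_of_superset (Ioo_mem_nhdsLT ht.1) fun s hs => ⟨hs.1, hs.2.le.trans ht.2⟩
  -- At `a` only the limit `k` is available, so the version with limits at both ends is needed.
  have h := intervalIntegral.integral_eq_sub_of_hasDerivAt_of_tendsto ht.1
    (fun s hs => ?_) hint hk ((hv.continuousOn t ht).mono_left (nhdsWithin_le_of_mem hmem))
  · simp only [fracInt, one_ne_zero, if_false, sub_self, Real.rpow_zero, mul_one, Real.Gamma_one,
      div_one, one_mul]
    linarith
  · have hs' : s ∈ Ioc a T := ⟨hs.1, hs.2.le.trans ht.2⟩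
    have hd := (hv s hs').hasDerivWithinAt.hasDerivAt
      (mem_of_superset (Ioo_mem_nhds hs.1 hs.2) fun z hz => ⟨hz.1, hz.2.le.trans ht.2⟩)
    have hne : dpsi a T ψ s ≠ 0 := hψ' s (Ioc_subset_Icc_self hs')
    rwa [psiDiff, ← mul_assoc, mul_one_div_cancel hne, one_mul]

/-- In the new variable the function is `(x - ψ(a))^{γ-1}` times a continuous function on the closed
interval, and `γ - 1 > -1`. -/
lemma memWeighted_comp_psiInv (haT : a < T) (hψc : ContinuousOn ψ (Icc a T))
    (hψ : StrictMonoOn ψ (Icc a T)) {γ : ℝ} (hγ : 0 < γ) {y : ℝ → ℝ}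
    (hy : MemWeighted a T ψ γ y) :
    ContinuousOn (y ∘ psiInv a T ψ) (Ioc (ψ a) (ψ T)) ∧
      IntegrableOn (y ∘ psiInv a T ψ) (Ioc (ψ a) (ψ T)) := by
  obtain ⟨Φ, hΦ, hΦy⟩ := hy
  have hΦc : ContinuousOn (Φ ∘ psiInv a T ψ) (Icc (ψ a) (ψ T)) :=
    hΦ.comp (continuousOn_psiInv haT.le hψc hψ) (mapsTo_psiInv_Icc haT.le hψc hψ)
  have heq : EqOn (fun x => (x - ψ a) ^ (γ - 1) * (Φ ∘ psiInv a T ψ) x) (y ∘ psiInv a T ψ)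
      (Ioc (ψ a) (ψ T)) := by
    rw [← image_psi_Ioc hψc hψ (right_mem_Icc.2 haT.le)]
    rintro _ ⟨t, ht, rfl⟩
    have hpos : 0 < ψ t - ψ a :=
      sub_pos.2 (hψ (left_mem_Icc.2 haT.le) (Ioc_subset_Icc_self ht) ht.1)
    simp only [Function.comp_apply]
    rw [psiInv_psi hψ (Ioc_subset_Icc_self ht), hΦy t ht, ← mul_assoc, ← Real.rpow_add hpos,
      show γ - 1 + (1 - γ) = 0 by ring, Real.rpow_zero, one_mul]
  constructor
  · refine ContinuousOn.congr ?_ heq.symm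
    refine ContinuousOn.mul ?_ (hΦc.mono Ioc_subset_Icc_self)
    exact ContinuousOn.rpow_const (by fun_prop) fun x hx => Or.inl (sub_pos.2 hx.1).ne'
  · refine IntegrableOn.congr_fun ?_ heq measurableSet_Ioc
    rw [← integrableOn_Icc_iff_integrableOn_Ioc]
    have hpow := integrableOn_sub_rpow (c := ψ a) (d := ψ T) hγ
    rw [← integrableOn_Icc_iff_integrableOn_Ioc] at hpow
    exact hpow.mul_continuousOn hΦc isCompact_Icc

lemma tendsto_psi_nhdsGT (haT : a < T) (hψc : ContinuousOn ψ (Icc a T))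
    (hψ : StrictMonoOn ψ (Icc a T)) : Tendsto ψ (𝓝[>] a) (𝓝[>] ψ a) := by
  refine tendsto_nhdsWithin_iff.2 ⟨?_, ?_⟩
  · exact (hψc a (left_mem_Icc.2 haT.le)).mono_left
      (nhdsWithin_le_of_mem (mem_of_superset (Ioc_mem_nhdsGT haT) Ioc_subset_Icc_self))
  · filter_upwards [Ioc_mem_nhdsGT haT] with t ht
    exact hψ (left_mem_Icc.2 haT.le) (Ioc_subset_Icc_self ht) ht.1

end PsiHilfer

end

/-! ### The equivalence -/

open PsiHilfer in
theorem lemma1 (a T : ℝ) (haT : a < T) (ψ : ℝ → ℝ)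
    (hψ : ContDiffOn ℝ 1 ψ (Icc a T)) (hψmono : MonotoneOn ψ (Icc a T))
    (hψ' : ∀ t ∈ Icc a T, derivWithin ψ (Icc a T) t ≠ 0)
    (α β γ : ℝ) (hα : 0 < α) (hα1 : α ≤ 1) (hβ : 0 ≤ β) (hβ1 : β ≤ 1)
    (hγ : γ = α + β * (1 - α))
    (f : ℝ → ℝ → ℝ → ℝ)
    (hf : ContinuousOn (fun p : ℝ × ℝ × ℝ => f p.1 p.2.1 p.2.2) (Icc a T ×ˢ univ))
    (ya : ℝ) (y : ℝ → ℝ) (hy : PsiHilfer.HilferDifferentiable a T ψ α β y) :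
    PsiHilfer.IsSolution a T ψ α β f ya y ↔
      ∃ g : ℝ → ℝ, ContinuousOn g (Icc a T) ∧
        (∀ t ∈ Ioc a T, g t = f t (PsiHilfer.volterra a T ψ α γ ya g t) (g t)) ∧
        ∀ t ∈ Ioc a T, y t = PsiHilfer.volterra a T ψ α γ ya g t := by
  have hψd := hψ.differentiableOn one_ne_zero
  have hψc := hψd.continuousOn
  have hψs := strictMonoOn_psi hψc hψmono hψ'
  have hσ : 0 ≤ β * (1 - α) := mul_nonneg hβ (sub_nonneg.2 hα1)
  have hασ : α + β * (1 - α) ≤ 1 := by nlinarith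
  have hγ0 : 0 < α + β * (1 - α) := by linarith
  have hν : (1 - β) * (1 - α) = 1 - (α + β * (1 - α)) := by ring
  obtain ⟨hyw, hyd, hyc, hyi⟩ := id hy
  obtain ⟨hYc, hYi⟩ := memWeighted_comp_psiInv haT hψc hψs hγ0 hyw
  have hWc := hyc.comp ((continuousOn_psiInv haT.le hψc hψs).mono Ioc_subset_Icc_self)
    (mapsTo_psiInv_Ioc haT.le hψc hψs)
  have hWi := integrableOn_comp_psiInv haT hψ hψmono hψ' hyi
  have hfrac : ∀ μ u, ∀ t ∈ Ioc a T, fracInt a T ψ μ u t =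
      rlInt (ψ a) μ (u ∘ psiInv a T ψ) (ψ t) := fun μ u t ht =>
    fracInt_eq_rlInt hψd hψmono hψ' μ u (Ioc_subset_Icc_self ht)
  have himage := image_psi_Ioc hψc hψs (right_mem_Icc.2 haT.le)
  have hinv : ∀ t ∈ Ioc a T, psiInv a T ψ (ψ t) = t := fun t ht =>
    psiInv_psi hψs (Ioc_subset_Icc_self ht)
  have hmaps : ∀ t ∈ Ioc a T, ψ t ∈ Ioc (ψ a) (ψ T) := fun t ht =>
    himage ▸ mem_image_of_mem ψ ht
  have hforall : ∀ {p : ℝ → Prop}, (∀ t ∈ Ioc a T, p (ψ t)) → ∀ x ∈ Ioc (ψ a) (ψ T), p x := by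
    intro p hp x hx
    rw [← himage] at hx
    obtain ⟨t, ht, rfl⟩ := hx
    exact hp t ht
  have hcomp : ∀ g : ℝ → ℝ, ContinuousOn g (Icc a T) →
      ContinuousOn (g ∘ psiInv a T ψ) (Icc (ψ a) (ψ T)) := fun g hg =>
    hg.comp (continuousOn_psiInv haT.le hψc hψs) (mapsTo_psiInv_Icc haT.le hψc hψs)
  have hvolterra : ∀ g, ∀ t ∈ Ioc a T, volterra a T ψ α γ ya g t =
      (ψ t - ψ a) ^ (α + β * (1 - α) - 1) / Real.Gamma (α + β * (1 - α)) * ya +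
        rlInt (ψ a) α (g ∘ psiInv a T ψ) (ψ t) := by
    intro g t ht
    rw [volterra, hγ, hfrac _ _ t ht]
  have hftc : Tendsto (fracInt a T ψ ((1 - β) * (1 - α)) y) (𝓝[>] a) (𝓝 ya) → ∀ t ∈ Ioc a T,
      rlInt (ψ a) (1 - (α + β * (1 - α))) (y ∘ psiInv a T ψ) (ψ t) = ya + rlInt (ψ a) 1
        (psiDiff a T ψ (fracInt a T ψ ((1 - β) * (1 - α)) y) ∘ psiInv a T ψ) (ψ t) := by
    intro hlim t ht
    have := eq_add_fracInt_one_psiDiff haT hψ hψ' hyd hyi hlim ht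
    rwa [hfrac _ _ t ht, hfrac _ _ t ht, congrArg (fun ν => rlInt (ψ a) ν (y ∘ psiInv a T ψ) (ψ t)) hν]
      at this
  constructor
  · rintro ⟨-, ⟨g, hg, hgD⟩, heq, hlim⟩
    rw [← hν] at hlim
    -- The witness `g` is the continuous extension of the Hilfer derivative.
    have hY := eq_add_rlInt_of_rlInt_eq hα hσ hασ hYc hYi hWi (hcomp g hg)
      (hforall fun t ht => by
        rw [← hfrac _ _ t ht, Function.comp_apply, hinv t ht, hgD t ht, hilferDeriv])
      (hforall (hftc hlim))
    have hyg : ∀ t ∈ Ioc a T, y t = volterra a T ψ α γ ya g t := by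
      intro t ht
      have := hY _ (hmaps t ht)
      rwa [Function.comp_apply, hinv t ht, ← hvolterra g t ht] at this
    refine ⟨g, hg, fun t ht => ?_, hyg⟩
    rw [← hyg t ht, hgD t ht]
    exact heq t ht
  · rintro ⟨g, hg, hgf, hyg⟩
    have hνY := rlInt_eq_add_rlInt hα hσ hασ (k := ya) (Y := y ∘ psiInv a T ψ) (hcomp g hg)
      (hforall fun t ht => by
        rw [Function.comp_apply, hinv t ht, hyg t ht, hvolterra g t ht])
    -- Since `α > 0`, the order `1 - σ` is positive, so `I^{1-σ} G` tends to `0` at `ψ(a)`.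
    have hσ1 : β * (1 - α) < 1 := by linarith
    have hlim : Tendsto (fracInt a T ψ (1 - (α + β * (1 - α))) y) (𝓝[>] a) (𝓝 ya) := by
      have h := ((tendsto_rlInt_nhdsGT (hψs (left_mem_Icc.2 haT.le) (right_mem_Icc.2 haT.le) haT)
        (sub_pos.2 hσ1) (hcomp g hg)).comp (tendsto_psi_nhdsGT haT hψc hψs)).const_add ya
      rw [add_zero] at h
      refine h.congr' ?_
      filter_upwards [Ioc_mem_nhdsGT haT] with t ht
      rw [hfrac _ _ t ht, hνY _ (hmaps t ht), Function.comp_apply]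
    -- With the initial limit established, `I^{1-γ} Y` has two expressions; cancelling `y_a` leaves
    -- `I^1 W = I^{1-σ} G`.
    have hσW := rlInt_eq_of_rlInt_one_eq hσ hσ1 hWc hWi (hcomp g hg)
      (hforall fun t ht => by
        have h1 := hftc (hν ▸ hlim) t ht
        have h2 := hνY _ (hmaps t ht)
        exact add_left_cancel (h1.symm.trans h2))
    have hD : ∀ t ∈ Ioc a T, hilferDeriv a T ψ α β y t = g t := by
      intro t ht
      rw [hilferDeriv, hfrac _ _ t ht, hσW _ (hmaps t ht), Function.comp_apply, hinv t ht]
    refine ⟨hy, ⟨g, hg, fun t ht => (hD t ht).symm⟩, fun t ht => ?_, hlim⟩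
    rw [hD t ht, hyg t ht]
    exact hgf t ht
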